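/- All rings are commutative with $1$, and $R$ is a ring. A finitely generated ideal $J$ of $R$ is a GV-ideal if the natural map $R\to \mathrm{Hom}_R(J,R)$, $r\mapsto (x\mapsto rx)$, is an isomorphism. An $R$-module $M$ is GV-torsion-free if no nonzero element of $M$ is annihilated by a GV-ideal, and a $w$-module if moreover $\mathrm{Ext}^1_R(R/J,M)=0$ for every GV-ideal $J$. A $w$-ideal is an ideal that is a $w$-module, and $R$ is a DW-ring if every ideal of $R$ is a $w$-ideal. Let $w\text{-}\mathrm{Max}(R)$ be the set of ideals maximal among the proper $w$-ideals; all of them are prime. A sequence $0\to A\to B\to C\to 0$ of $R$-modules is $w$-exact if $0\to A_{\mathfrak p}\to B_{\mathfrak p}\to C_{\mathfrak p}\to 0$ is exact for every $\mathfrak p\in w\text{-}\mathrm{Max}(R)$. A submodule $A\subseteq B$ is $w$-pure if $0\to A\otimes_R N\to B\otimes_R N\to (B/A)\otimes_R N\to 0$ is $w$-exact for every $R$-module $N$. A module $A$ is absolutely $w$-pure if it is a $w$-pure submodule of every $R$-module containing it. An $R$-module $M$ is $w$-FP-projective if $\mathrm{Ext}^1_R(M,A)=0$ for every absolutely $w$-pure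 $R$-module $A$. **Proposition.** Let $(R,\mathfrak m)$ be a local ring (not necessarily Noetherian). If $R$ is not a DW-ring, then every finitely generated $w$-FP-projective $R$-module is free. In particular this applies to regular local rings of global dimension at least $2$: no such ring is a DW-ring. -/

import Mathlib

open CategoryTheory

open scoped TensorProduct

universe u

/-- A Glaz--Vasconcelos ideal: `J` is finitely generated and the natural homomorphism
`R → Hom_R(J, R)`, `r ↦ (x ↦ r x)`, is an isomorphism. -/
def IsGVIdeal {R : Type u} [CommRing R] (J : Ideal R) : Prop :=
  J.FG ∧ Function.Bijective (LinearMap.toSpanSingleton R (J →ₗ[R] R) J.subtype)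

/-- The elements of `M` annihilated by some GV-ideal. -/
def gvTorsion (R : Type u) [CommRing R] (M : Type u) [AddCommGroup M] [Module R M] : Set M :=
  {x | ∃ J : Ideal R, IsGVIdeal J ∧ ∀ a ∈ J, a • x = 0}

/-- `M` is GV-torsion-free. -/
def IsGVTorsionFree (R : Type u) [CommRing R] (M : Type u) [AddCommGroup M] [Module R M] : Prop :=
  gvTorsion R M = {0}

/-- `M` is a `w`-module: it is GV-torsion-free and `Ext¹_R(R/J, M) = 0` for all GV-ideals `J`. -/
def IsWModule (R : Type u) [CommRing R] (M : Type u) [AddCommGroup M] [Module R M] : Prop :=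
  IsGVTorsionFree R M ∧
    ∀ J : Ideal R, IsGVIdeal J →
      Subsingleton (Abelian.Ext (ModuleCat.of R (R ⧸ J)) (ModuleCat.of R M) 1)

/-- A `w`-ideal is an ideal that is a `w`-module. -/
def IsWIdeal {R : Type u} [CommRing R] (I : Ideal R) : Prop :=
  IsWModule R I

/-- A DW-ring: every ideal is a `w`-ideal. -/
def IsDWRing (R : Type u) [CommRing R] : Prop :=
  ∀ I : Ideal R, IsWIdeal I

/-- `p ∈ w-Max(R)`: `p` is maximal among the proper `w`-ideals. -/
def IsMaximalWIdeal {R : Type u} [CommRing R] (p : Ideal R) : Prop :=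
  Maximal (fun I : Ideal R => I ≠ ⊤ ∧ IsWIdeal I) p

/-- `0 → A → B → C → 0` is `w`-exact: it becomes exact after localization at every maximal
`w`-ideal `p`. Every maximal `w`-ideal is prime, so the binder `[p.IsPrime]`, which is
needed to form the localization, excludes none of them. -/
def IsWExact {R : Type u} [CommRing R] {A B C : Type u}
    [AddCommGroup A] [Module R A] [AddCommGroup B] [Module R B] [AddCommGroup C] [Module R C]
    (f : A →ₗ[R] B) (g : B →ₗ[R] C) : Prop :=
  ∀ (p : Ideal R) [p.IsPrime], IsMaximalWIdeal p →
    Function.Injective (LocalizedModule.map p.primeCompl f) ∧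
    Function.Exact (LocalizedModule.map p.primeCompl f) (LocalizedModule.map p.primeCompl g) ∧
    Function.Surjective (LocalizedModule.map p.primeCompl g)

/-- A `w`-exact sequence that stays `w`-exact after tensoring with any module. -/
def IsWPureExact {R : Type u} [CommRing R] {A B C : Type u}
    [AddCommGroup A] [Module R A] [AddCommGroup B] [Module R B] [AddCommGroup C] [Module R C]
    (f : A →ₗ[R] B) (g : B →ₗ[R] C) : Prop :=
  IsWExact f g ∧
    ∀ (M : Type u) [AddCommGroup M] [Module R M], IsWExact (f.rTensor M) (g.rTensor M)

/-- `A` is a `w`-pure submodule of `B`. -/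
def IsWPureSubmodule {R : Type u} [CommRing R] {B : Type u} [AddCommGroup B] [Module R B]
    (A : Submodule R B) : Prop :=
  IsWPureExact A.subtype A.mkQ

/-- `A` is absolutely `w`-pure: it is a `w`-pure submodule of every module that contains it,
that is, its image under every injective homomorphism is a `w`-pure submodule. -/
def IsAbsolutelyWPure (R : Type u) [CommRing R] (A : Type u) [AddCommGroup A] [Module R A] :
    Prop :=
  ∀ (B : Type u) [AddCommGroup B] [Module R B] (f : A →ₗ[R] B),
    Function.Injective f → IsWPureSubmodule (LinearMap.range f)

/-- `M` is `w`-FP-projective: `Ext¹_R(M, A) = 0` for every absolutely `w`-pure module `A`. -/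
def IsWFPProjective (R : Type u) [CommRing R] (M : Type u) [AddCommGroup M] [Module R M] :
    Prop :=
  ∀ (A : Type u) [AddCommGroup A] [Module R A], IsAbsolutelyWPure R A →
    Subsingleton (Abelian.Ext (ModuleCat.of R M) (ModuleCat.of R A) 1)

/-- The global dimension: the supremum of the projective dimensions of all modules. -/
noncomputable def ringGlobalDim (R : Type u) [CommRing R] : WithBot ℕ∞ :=
  ⨆ M : ModuleCat.{u} R, projectiveDimension M

/-! If `R` is not a DW-ring, some GV-ideal `J` is proper, so `J ⊆ 𝔪`. No maximal `w`-ideal contains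
`J`, so modules killed by `J` vanish at all of these primes and are absolutely `w`-pure; this covers
every vector space over `k = R/𝔪`. Write `M = F/K` with `F` finite free. Since `Ext¹(M, k ⊗ K) = 0`,
the map `K → k ⊗ K` extends to `F`, which makes `k ⊗ K → k ⊗ F` injective. Moreover `K` is finitely
generated, because `Ext¹(M, -)` vanishes on absolutely pure modules. These two facts force `M` to be
free.

In a regular local ring every `x ∈ 𝔪 \ 𝔪²` is prime. If the global dimension is at least `2`, then
`𝔪 ≠ (x)`, as otherwise `R` would be a principal ideal domain. Hence `𝔪` strictly contains a
principal prime, which makes it a proper GV-ideal. -/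

/-- If `Ext¹(C, N) = 0`, then homomorphisms to `N` extend along the kernel of a surjection
onto `C`. -/
theorem exists_extension_of_subsingleton_ext {R : Type u} [CommRing R] {B C N : Type u}
    [AddCommGroup B] [Module R B] [AddCommGroup C] [Module R C] [AddCommGroup N] [Module R N]
    (g : B →ₗ[R] C) (hg : Function.Surjective g)
    (hN : Subsingleton (Abelian.Ext (ModuleCat.of R C) (ModuleCat.of R N) 1))
    (φ : LinearMap.ker g →ₗ[R] N) :
    ∃ ψ : B →ₗ[R] N, ψ ∘ₗ (LinearMap.ker g).subtype = φ := by
  obtain ⟨ψ, hψ⟩ := Abelian.Ext.contravariant_sequence_exact₁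
    (LinearMap.shortExact_shortComplexKer hg) (ModuleCat.of R N)
    (Abelian.Ext.mk₀ (ModuleCat.ofHom φ)) (n₁ := 1) rfl
    (Subsingleton.elim (α := Abelian.Ext (ModuleCat.of R C) (ModuleCat.of R N) 1) _ _)
  obtain ⟨ψ, rfl⟩ := Abelian.Ext.homEquiv₀.symm.surjective ψ
  refine ⟨ψ.hom, ?_⟩
  rw [Abelian.Ext.homEquiv₀_symm_apply, Abelian.Ext.mk₀_comp_mk₀] at hψ
  have := Abelian.Ext.homEquiv₀.symm.injective hψ
  ext x
  exact congr($(this).hom x)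

/-- Every module embeds into an injective module. -/
theorem exists_injective_embedding (R : Type u) [CommRing R] (M : Type u) [AddCommGroup M]
    [Module R M] : ∃ (I : Type u) (_ : AddCommGroup I) (_ : Module R I) (_ : Module.Injective R I)
      (i : M →ₗ[R] I), Function.Injective i := by
  let P := Injective.under (ModuleCat.of R M)
  refine ⟨P, inferInstance, inferInstance,
    (Module.injective_iff_injective_object R P).mpr (inferInstanceAs (Injective P)),
    (Injective.ι (ModuleCat.of R M)).hom, ?_⟩
  exact (ModuleCat.mono_iff_injective _).mp inferInstance

/-! ### GV-ideals and `w`-ideals -/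

/-- A GV-ideal has zero annihilator. -/
theorem IsGVIdeal.eq_zero_of_forall_mul {R : Type u} [CommRing R] {J : Ideal R} (hJ : IsGVIdeal J)
    {r : R} (h : ∀ a ∈ J, r * a = 0) : r = 0 := by
  apply hJ.2.1
  ext x
  simpa using h x x.2

theorem isGVIdeal_top (R : Type u) [CommRing R] : IsGVIdeal (⊤ : Ideal R) := by
  refine ⟨Ideal.fg_top R, fun r s h ↦ ?_, fun f ↦ ⟨f ⟨1, trivial⟩, ?_⟩⟩
  · simpa using LinearMap.congr_fun h ⟨1, trivial⟩
  · ext x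
    simp only [LinearMap.toSpanSingleton_apply, LinearMap.smul_apply, Submodule.subtype_apply,
      smul_eq_mul]
    rw [mul_comm, ← smul_eq_mul, ← map_smul]
    congr 1
    ext
    simp

/-- A `w`-ideal containing a GV-ideal is the unit ideal. -/
theorem IsWIdeal.eq_top_of_le {R : Type u} [CommRing R] {I J : Ideal R} (hI : IsWIdeal I)
    (hJ : IsGVIdeal J) (hJI : J ≤ I) : I = ⊤ := by
  have hker : LinearMap.ker J.mkQ = J := Submodule.ker_mkQ J
  obtain ⟨ψ, hψ⟩ := exists_extension_of_subsingleton_ext J.mkQ J.mkQ_surjective (hI.2 J hJ)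
    (Submodule.inclusion (hker.le.trans hJI))
  -- `ψ` extends the inclusion `J → I` to `R`, so `ψ 1 - 1` annihilates `J`.
  have key : (ψ 1 : R) - 1 = 0 := hJ.eq_zero_of_forall_mul fun a ha ↦ by
    have h1 : ψ a = ⟨a, hJI ha⟩ := LinearMap.congr_fun hψ ⟨a, hker.ge ha⟩
    have h2 : ψ a = a • ψ 1 := by rw [← map_smul, smul_eq_mul, mul_one]
    have h3 : a = a * (ψ 1 : R) := by simpa [h1] using congrArg Subtype.val h2
    linear_combination -h3
  rw [Ideal.eq_top_iff_one, ← sub_eq_zero.mp key]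
  exact (ψ 1).2

/-- A ring without proper GV-ideals is a DW-ring. -/
theorem isDWRing_of_forall_isGVIdeal {R : Type u} [CommRing R]
    (h : ∀ J : Ideal R, IsGVIdeal J → J = ⊤) : IsDWRing R := by
  refine fun I ↦ ⟨?_, fun J hJ ↦ ?_⟩
  · ext x
    refine ⟨?_, ?_⟩
    · rintro ⟨J, hJ, hx⟩
      simpa using hx 1 (h J hJ ▸ trivial)
    · rintro rfl
      exact ⟨⊤, isGVIdeal_top R, fun a _ ↦ smul_zero a⟩
  · have : Subsingleton (R ⧸ J) := Ideal.Quotient.subsingleton_iff.mpr (h J hJ)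
    have : Projective (ModuleCat.of R (R ⧸ J)) :=
      (ModuleCat.isZero_of_subsingleton (ModuleCat.of R (R ⧸ J))).projective
    exact ⟨fun a b ↦ by rw [a.eq_zero_of_projective, b.eq_zero_of_projective]⟩

/-- A ring with a proper GV-ideal is not a DW-ring. -/
theorem IsGVIdeal.not_isDWRing {R : Type u} [CommRing R] {J : Ideal R} (hJ : IsGVIdeal J)
    (hJtop : J ≠ ⊤) : ¬ IsDWRing R :=
  fun h ↦ hJtop ((h J).eq_top_of_le hJ le_rfl)

/-! ### Absolutely `w`-pure modules -/

/-- A submodule is `w`-pure if its inclusion tensored with any module is injective at every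
maximal `w`-ideal. -/
theorem isWPureSubmodule_of_injective {R : Type u} [CommRing R] {B : Type u} [AddCommGroup B]
    [Module R B] (A : Submodule R B)
    (h : ∀ (p : Ideal R) [p.IsPrime], IsMaximalWIdeal p → ∀ (M : Type u) [AddCommGroup M]
      [Module R M], Function.Injective
        (LocalizedModule.map p.primeCompl (A.subtype.rTensor M))) :
    IsWPureSubmodule A := by
  refine ⟨fun p _ hp ↦ ⟨?_, ?_, ?_⟩, fun M _ _ p _ hp ↦ ⟨h p hp M, ?_, ?_⟩⟩
  · exact LocalizedModule.map_injective _ _ A.subtype_injective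
  · exact LocalizedModule.map_exact _ _ _ (LinearMap.exact_subtype_mkQ A)
  · exact LocalizedModule.map_surjective _ _ A.mkQ_surjective
  · exact LocalizedModule.map_exact _ _ _
      (rTensor_exact M (LinearMap.exact_subtype_mkQ A) A.mkQ_surjective)
  · exact LocalizedModule.map_surjective _ _ (LinearMap.rTensor_surjective M A.mkQ_surjective)

/-- A module annihilated by a GV-ideal is absolutely `w`-pure. -/
theorem IsGVIdeal.isAbsolutelyWPure {R : Type u} [CommRing R] {J : Ideal R} (hJ : IsGVIdeal J)
    {T : Type u} [AddCommGroup T] [Module R T] (hT : ∀ a ∈ J, ∀ t : T, a • t = 0) :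
    IsAbsolutelyWPure R T := by
  intro B _ _ f hf
  refine isWPureSubmodule_of_injective _ fun p _ hp M _ _ ↦ ?_
  -- This `a` becomes a unit at `p` and kills the tensor product, so the localization is zero.
  obtain ⟨a, haJ, hap⟩ : ∃ a ∈ J, a ∉ p := by
    by_contra! hle
    exact hp.1.1 (hp.1.2.eq_top_of_le hJ hle)
  have hz : ∀ z : LinearMap.range f ⊗[R] M, a • z = 0 := fun z ↦ by
    induction z with
    | zero => exact smul_zero a
    | add x y hx hy => rw [smul_add, hx, hy, add_zero]
    | tmul x m =>
      obtain ⟨_, t, rfl⟩ := x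
      have : a • (⟨f t, t, rfl⟩ : LinearMap.range f) = 0 := by
        ext
        simp [← map_smul, hT a haJ t]
      rw [TensorProduct.smul_tmul', this, TensorProduct.zero_tmul]
  have : Subsingleton (LocalizedModule p.primeCompl (LinearMap.range f ⊗[R] M)) :=
    LocalizedModule.subsingleton_iff.mpr fun z ↦ ⟨a, hap, hz z⟩
  exact Function.injective_of_subsingleton _

/-! ### Finite presentation and freeness -/

/-- A finitely generated `w`-FP-projective module is finitely presented. With `K = ker g`
and the `K / Q` embedded into injective modules `I Q`, the families in `∏ Q, I Q` that vanish above
some finitely generated `P ≤ K` form an absolutely pure module, and every homomorphism from `F` to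
it has image in the families that vanish above one fixed `P`. -/
theorem IsWFPProjective.fg_ker {R : Type u} [CommRing R] {F M : Type u} [AddCommGroup F]
    [Module R F] [Module.Finite R F] [AddCommGroup M] [Module R M] (hM : IsWFPProjective R M)
    (g : F →ₗ[R] M) (hg : Function.Surjective g) : (LinearMap.ker g).FG := by
  classical
  let K := LinearMap.ker g
  choose I _ _ _ i hi using fun Q : Submodule R K ↦ exists_injective_embedding R (K ⧸ Q)
  let A : Submodule R (∀ Q, I Q) :=
    { carrier := {x | ∃ P : Submodule R K, P.FG ∧ ∀ Q, P ≤ Q → x Q = 0}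
      zero_mem' := ⟨⊥, Submodule.fg_bot, fun _ _ ↦ rfl⟩
      add_mem' := by
        rintro x y ⟨P, hP, hx⟩ ⟨P', hP', hy⟩
        exact ⟨P ⊔ P', hP.sup hP', fun Q hQ ↦ by
          simp [hx Q (le_sup_left.trans hQ), hy Q (le_sup_right.trans hQ)]⟩
      smul_mem' := by
        rintro r x ⟨P, hP, hx⟩
        exact ⟨P, hP, fun Q hQ ↦ by simp [hx Q hQ]⟩ }
  have hA : IsAbsolutelyWPure R A := by
    intro B _ _ f hf
    refine isWPureSubmodule_of_injective _ fun p _ _ N _ _ ↦ LocalizedModule.map_injective _ _ ?_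
    rw [injective_iff_map_eq_zero]
    intro z hz
    -- A tensor involves only finitely many elements of `A`, so one `P` serves them all.
    have key : ∀ z : LinearMap.range f ⊗[R] N, ∃ P : Submodule R K, P.FG ∧
        ∀ h : LinearMap.range f →ₗ[R] LinearMap.range f,
          (∀ a : A, (∀ Q, P ≤ Q → a.1 Q = 0) → h (f.rangeRestrict a) = f.rangeRestrict a) →
            h.rTensor N z = z := by
      intro z
      induction z with
      | zero => exact ⟨⊥, Submodule.fg_bot, fun _ _ ↦ map_zero _⟩
      | add x y hx hy =>
        obtain ⟨P, hP, hx⟩ := hx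
        obtain ⟨P', hP', hy⟩ := hy
        refine ⟨P ⊔ P', hP.sup hP', fun h hh ↦ ?_⟩
        rw [map_add, hx h fun a ha ↦ hh a fun Q hQ ↦ ha Q (le_sup_left.trans hQ),
          hy h fun a ha ↦ hh a fun Q hQ ↦ ha Q (le_sup_right.trans hQ)]
      | tmul x n =>
        obtain ⟨_, a, rfl⟩ := x
        obtain ⟨P, hP, ha⟩ := a.2
        exact ⟨P, hP, fun h hh ↦ by
          rw [LinearMap.rTensor_tmul]
          exact congrArg (· ⊗ₜ[R] n) (hh a ha)⟩
    obtain ⟨P, hP, hPz⟩ := key z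
    choose e he using fun Q ↦
      Module.Injective.out f hf ((LinearMap.proj Q : _ →ₗ[R] I Q) ∘ₗ A.subtype)
    -- Zeroing the coordinates above `P` forces the values into `A`, yet `r` still retracts the part
    -- of `A` that `z` uses.
    let r : B →ₗ[R] A :=
      (LinearMap.pi fun Q ↦ if P ≤ Q then 0 else e Q).codRestrict A
        fun b ↦ ⟨P, hP, fun Q hQ ↦ by simp [hQ]⟩
    have hr : ∀ a : A, (∀ Q, P ≤ Q → a.1 Q = 0) → r (f a) = a := by
      intro a ha
      ext Q
      by_cases hQ : P ≤ Q
      · simp [r, hQ, ha Q hQ]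
      · simpa [r, hQ] using he Q a
    rw [← hPz (f.rangeRestrict ∘ₗ r ∘ₗ (LinearMap.range f).subtype) fun a ha ↦
      congrArg f.rangeRestrict (hr a ha), ← LinearMap.comp_assoc, LinearMap.rTensor_comp,
      LinearMap.comp_apply, hz, map_zero]
  let φ : K →ₗ[R] A := (LinearMap.pi fun Q ↦ i Q ∘ₗ Q.mkQ).codRestrict A fun x ↦
    ⟨R ∙ x, Submodule.fg_span_singleton x, fun Q hQ ↦ by
      have : Q.mkQ x = 0 := by
        rw [← LinearMap.mem_ker, Submodule.ker_mkQ]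
        exact hQ (Submodule.mem_span_singleton_self x)
      rw [LinearMap.pi_apply, LinearMap.comp_apply, this, map_zero]⟩
  obtain ⟨ψ, hψ⟩ := exists_extension_of_subsingleton_ext g hg (hM A hA) φ
  have key : ∀ S : Submodule R F, S.FG → ∃ P : Submodule R K, P.FG ∧
      ∀ x ∈ S, ∀ Q, P ≤ Q → (ψ x).1 Q = 0 := by
    intro S hS
    induction S, hS using Submodule.fg_induction with
    | singleton x =>
      obtain ⟨P, hP, hx⟩ := (ψ x).2
      refine ⟨P, hP, fun y hy Q hQ ↦ ?_⟩
      obtain ⟨r, rfl⟩ := Submodule.mem_span_singleton.mp hy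
      simp [hx Q hQ]
    | sup S T hS hT hS' hT' =>
      obtain ⟨P, hP, h⟩ := hS'
      obtain ⟨P', hP', h'⟩ := hT'
      refine ⟨P ⊔ P', hP.sup hP', fun y hy Q hQ ↦ ?_⟩
      obtain ⟨s, hs, t, ht, rfl⟩ := Submodule.mem_sup.mp hy
      simp [h s hs Q (le_sup_left.trans hQ), h' t ht Q (le_sup_right.trans hQ)]
  obtain ⟨P, hP, hPψ⟩ := key ⊤ Module.Finite.fg_top
  -- The coordinate of `φ x` at `Q = P` is the class of `x` in `K / P`, embedded in `I P`; it
  -- vanishes, so `x ∈ P`.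
  have hPtop : P = ⊤ := by
    rw [eq_top_iff]
    intro x _
    have h1 : i P (P.mkQ x) = 0 := by
      have := hPψ x trivial P le_rfl
      rwa [show ψ x = φ x from LinearMap.congr_fun hψ x] at this
    rw [← Submodule.ker_mkQ P, LinearMap.mem_ker]
    exact hi P (h1.trans (map_zero _).symm)
  rw [← Module.Finite.iff_fg]
  exact ⟨hPtop ▸ hP⟩

/-- Over a local ring that is not a DW-ring, finitely generated `w`-FP-projective modules are
free. -/
theorem IsWFPProjective.free_of_not_isDWRing {R : Type u} [CommRing R] [IsLocalRing R]
    (hR : ¬ IsDWRing R) {M : Type u} [AddCommGroup M] [Module R M] [Module.Finite R M]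
    (hM : IsWFPProjective R M) : Module.Free R M := by
  obtain ⟨J, hJ, hJtop⟩ : ∃ J : Ideal R, IsGVIdeal J ∧ J ≠ ⊤ := by
    by_contra! h
    exact hR (isDWRing_of_forall_isGVIdeal h)
  have hJm := IsLocalRing.le_maximalIdeal hJtop
  obtain ⟨F, _, _, _, _, g, hg⟩ := Module.exists_finite_presentation R M
  have : Module.Finite R (LinearMap.ker g) := Module.Finite.iff_fg.mpr (hM.fg_ker g hg)
  let k := IsLocalRing.ResidueField R
  let ι := TensorProduct.mk R k (LinearMap.ker g) 1
  obtain ⟨ψ, hψ⟩ := exists_extension_of_subsingleton_ext g hg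
    (hM (k ⊗[R] LinearMap.ker g) (hJ.isAbsolutelyWPure fun a ha t ↦ by
      have : algebraMap R k a = 0 := (IsLocalRing.residue_eq_zero_iff a).mpr (hJm ha)
      rw [← algebraMap_smul k a t, this, zero_smul])) ι
  refine Module.free_of_lTensor_residueField_injective (LinearMap.ker g).subtype g hg
    (LinearMap.exact_subtype_ker_map g) ?_
  -- The base change of `ψ` is a retraction of `k ⊗ K → k ⊗ F`.
  refine Function.LeftInverse.injective (g := LinearMap.liftBaseChange k ψ) fun z ↦ ?_
  induction z with
  | zero => simp
  | add x y hx hy => rw [map_add, map_add, hx, hy]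
  | tmul r x =>
    rw [LinearMap.lTensor_tmul, LinearMap.liftBaseChange_tmul,
      show ψ ((LinearMap.ker g).subtype x) = 1 ⊗ₜ x from LinearMap.congr_fun hψ x,
      TensorProduct.smul_tmul', smul_eq_mul, mul_one]

/-! ### Regular local rings -/

open IsLocalRing in
/-- Dividing by an element outside the square of the maximal ideal lowers the embedding
dimension. -/
theorem spanFinrank_maximalIdeal_quotient_add_one_le {R : Type u} [CommRing R] [IsLocalRing R]
    [IsNoetherianRing R] {x : R} (hx : x ∈ maximalIdeal R) (hx2 : x ∉ maximalIdeal R ^ 2)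
    [IsLocalRing (R ⧸ Ideal.span {x})] :
    (maximalIdeal (R ⧸ Ideal.span {x})).spanFinrank + 1 ≤ (maximalIdeal R).spanFinrank := by
  classical
  obtain ⟨s, hs, hspan⟩ :=
    Submodule.FG.exists_span_finset_card_eq_spanFinrank (maximalIdeal R).fg_of_isNoetherianRing
  obtain ⟨f, -, hf⟩ := Submodule.mem_span_finset.mp (hspan.ge hx)
  -- With all coefficients in `𝔪`, `x` would lie in `𝔪²`. A generator with unit coefficient is
  -- redundant modulo `x`.
  obtain ⟨a, ha, hfa⟩ : ∃ a ∈ s, IsUnit (f a) := by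
    by_contra! h
    refine hx2 (hf ▸ Ideal.sum_mem _ fun a ha ↦ ?_)
    rw [pow_two, smul_eq_mul]
    exact Ideal.mul_mem_mul ((mem_maximalIdeal _).mpr (h a ha)) (hspan.le (Submodule.subset_span ha))
  let π := Ideal.Quotient.mk (Ideal.span {x})
  have hπx : π x = 0 := Ideal.Quotient.eq_zero_iff_mem.mpr (Ideal.mem_span_singleton_self x)
  have hmap : maximalIdeal (R ⧸ Ideal.span {x}) = (maximalIdeal R).map π :=
    (map_maximalIdeal_of_surjective π Ideal.Quotient.mk_surjective).symm
  have hle : maximalIdeal (R ⧸ Ideal.span {x}) ≤ Ideal.span (π '' (s.erase a : Finset R)) := by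
    have haT : π a ∈ Ideal.span (π '' (s.erase a : Finset R)) := by
      have h0 : π (f a) * π a = - ∑ b ∈ s.erase a, π (f b) * π b := by
        rw [eq_neg_iff_add_eq_zero, Finset.add_sum_erase s (fun b ↦ π (f b) * π b) ha]
        simpa only [map_sum, smul_eq_mul, map_mul, hπx] using congrArg π hf
      rw [← Ideal.unit_mul_mem_iff_mem _ (hfa.map π), h0]
      exact neg_mem (Ideal.sum_mem _ fun b hb ↦ Ideal.mul_mem_left _ _
        (Ideal.subset_span ⟨b, hb, rfl⟩))
    rw [hmap, ← hspan, Ideal.map_span, Ideal.span_le]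
    rintro _ ⟨b, hb, rfl⟩
    by_cases hba : b = a
    · exact hba ▸ haT
    · exact Ideal.subset_span ⟨b, Finset.mem_erase.mpr ⟨hba, hb⟩, rfl⟩
  have heq : maximalIdeal (R ⧸ Ideal.span {x}) = Ideal.span (π '' (s.erase a : Finset R)) := by
    refine hle.antisymm ?_
    rw [hmap, ← Ideal.map_span]
    exact Ideal.map_mono ((Ideal.span_mono (Finset.erase_subset a s)).trans hspan.le)
  rw [heq, ← hs, ← Finset.card_erase_add_one ha, add_le_add_iff_right]
  refine (Submodule.spanFinrank_span_le_ncard_of_finite ((Finset.finite_toSet _).image _)).trans ?_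
  exact (Set.ncard_image_le (Finset.finite_toSet _)).trans (Set.ncard_coe_finset _).le

open IsLocalRing in
theorem isLocalRing_quotient_span_singleton {R : Type u} [CommRing R] [IsLocalRing R] {x : R}
    (hx : x ∈ maximalIdeal R) : IsLocalRing (R ⧸ Ideal.span {x}) :=
  have : Nontrivial (R ⧸ Ideal.span {x}) := Ideal.Quotient.nontrivial_iff.mpr
    fun h ↦ (mem_maximalIdeal x).mp hx (Ideal.span_singleton_eq_top.mp h)
  .of_surjective' _ Ideal.Quotient.mk_surjective

open IsLocalRing in
/-- The quotient of a regular local ring by an element of `𝔪 \ 𝔪²` is regular. -/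
theorem IsRegularLocalRing.quotient_span_singleton {R : Type u} [CommRing R]
    [IsRegularLocalRing R] {x : R} (hx : x ∈ maximalIdeal R) (hx2 : x ∉ maximalIdeal R ^ 2) :
    IsRegularLocalRing (R ⧸ Ideal.span {x}) := by
  have := isLocalRing_quotient_span_singleton hx
  apply IsRegularLocalRing.of_spanFinrank_maximalIdeal_le
  have h1 := spanFinrank_maximalIdeal_quotient_add_one_le hx hx2
  have h2 : ringKrullDim R ≤ ringKrullDim (R ⧸ Ideal.span {x}) + 1 := by
    simpa using
      ringKrullDim_le_ringKrullDim_quotient_add_encard {x}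
        (by simpa [IsLocalRing.ringJacobson_eq_maximalIdeal] using hx)
  rw [← IsRegularLocalRing.spanFinrank_maximalIdeal] at h2
  have h3 : ((maximalIdeal (R ⧸ Ideal.span {x})).spanFinrank : WithBot ℕ∞) + 1 ≤
      ringKrullDim (R ⧸ Ideal.span {x}) + 1 := le_trans (by exact_mod_cast h1) h2
  exact (ENat.WithBot.add_le_add_one_right_iff).mp h3

open IsLocalRing in
/-- Regular local rings are domains. -/
theorem IsRegularLocalRing.isDomain (R : Type u) [CommRing R] [IsRegularLocalRing R] :
    IsDomain R := by
  induction hn : (maximalIdeal R).spanFinrank using Nat.strong_induction_on generalizing R with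
  | _ n ih =>
  by_cases h0 : maximalIdeal R = ⊥
  · exact (isField_iff_maximalIdeal_eq.mpr h0).isDomain
  have hfg := (maximalIdeal R).fg_of_isNoetherianRing
  -- Prime avoidance, which tolerates the possibly non-prime `𝔪²`. Nakayama excludes `𝔪 ⊆ 𝔪²`; a
  -- minimal `𝔪` would give dimension `0`, hence `𝔪 = 0`.
  obtain ⟨x, hx, hxs⟩ : ∃ x ∈ maximalIdeal R,
      x ∉ ⋃ I ∈ insert (maximalIdeal R ^ 2) (minimalPrimes R), (I : Set R) := by
    refine Set.not_subset.mp ((Ideal.subset_union_prime_finite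
      ((minimalPrimes.finite_of_isNoetherianRing R).insert _) (f := id)
      (maximalIdeal R ^ 2) (maximalIdeal R ^ 2) ?_).not.mpr ?_)
    · rintro I (rfl | hI) h _
      · exact absurd rfl h
      · exact hI.1.1
    · rintro ⟨I, rfl | hI, hle⟩
      · refine h0 (Submodule.eq_bot_of_le_smul_of_le_jacobson_bot (maximalIdeal R) _ hfg ?_ ?_)
        · rwa [smul_eq_mul, ← pow_two]
        · exact (jacobson_eq_maximalIdeal ⊥ bot_ne_top).ge
      · have hm : maximalIdeal R ∈ minimalPrimes R :=
          hle.antisymm (le_maximalIdeal hI.1.1.ne_top) ▸ hI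
        have hh := maximalIdeal_height_eq_ringKrullDim (R := R)
        rw [Ideal.height_eq_zero_iff.mpr hm, ← IsRegularLocalRing.spanFinrank_maximalIdeal] at hh
        exact h0 ((Submodule.spanFinrank_eq_zero_iff_eq_bot hfg).mp (by exact_mod_cast hh.symm))
  simp only [Set.mem_insert_iff, Set.iUnion_iUnion_eq_or_left, Set.mem_union, SetLike.mem_coe,
    Set.mem_iUnion, not_or, not_exists] at hxs
  have hreg := IsRegularLocalRing.quotient_span_singleton hx hxs.1
  have hdom := ih _ (hn ▸ spanFinrank_maximalIdeal_quotient_add_one_le hx hxs.1)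
    (R ⧸ Ideal.span {x}) rfl
  have hprime : (Ideal.span {x}).IsPrime := (Ideal.Quotient.isDomain_iff_prime _).mp hdom
  obtain ⟨q, hq, hqx⟩ := Ideal.exists_minimalPrimes_le (bot_le (a := Ideal.span {x}))
  -- If `y = x z ∈ q`, then `z ∈ q` because `x ∉ q`; so `q ⊆ 𝔪 q` and Nakayama applies.
  have hq0 : q = ⊥ := by
    refine Submodule.eq_bot_of_le_smul_of_le_jacobson_bot (maximalIdeal R) _
      q.fg_of_isNoetherianRing (fun y hy ↦ ?_) (jacobson_eq_maximalIdeal ⊥ bot_ne_top).ge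
    obtain ⟨z, rfl⟩ := Ideal.mem_span_singleton.mp (hqx hy)
    exact Ideal.mul_mem_mul hx ((hq.1.1.mem_or_mem hy).resolve_left (hxs.2 q hq))
  exact (IsDomain.of_bot_isPrime R (hbp := hq0 ▸ hq.1.1))

/-- A finitely generated ideal of a domain that strictly contains a nonzero principal prime ideal
is a GV-ideal. -/
theorem isGVIdeal_of_prime_of_lt {R : Type u} [CommRing R] [IsDomain R] {J : Ideal R}
    (hJ : J.FG) {x : R} (hx : Prime x) (hlt : Ideal.span {x} < J) : IsGVIdeal J := by
  have hxJ : x ∈ J := hlt.le (Ideal.mem_span_singleton_self x)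
  have hsymm : ∀ (f : J →ₗ[R] R) (a b : J), (a : R) * f b = b * f a := fun f a b ↦ by
    rw [← smul_eq_mul, ← smul_eq_mul, ← map_smul, ← map_smul]
    congr 1
    ext
    exact mul_comm _ _
  refine ⟨hJ, fun r s h ↦ ?_, fun f ↦ ?_⟩
  · exact mul_right_cancel₀ hx.ne_zero (by simpa using LinearMap.congr_fun h ⟨x, hxJ⟩)
  · obtain ⟨y, hyJ, hyx⟩ := SetLike.exists_of_lt hlt
    -- From `y f(x) = x f(y)` and `x ∤ y`, primality gives `x ∣ f(x)`; the quotient is the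
    -- multiplier.
    obtain ⟨r, hr⟩ : x ∣ f ⟨x, hxJ⟩ :=
      (hx.dvd_or_dvd ⟨_, (hsymm f ⟨x, hxJ⟩ ⟨y, hyJ⟩).symm⟩).resolve_left
        fun h ↦ hyx (Ideal.mem_span_singleton.mpr h)
    refine ⟨r, LinearMap.ext fun z ↦ mul_left_cancel₀ hx.ne_zero ?_⟩
    have := hsymm f ⟨x, hxJ⟩ z
    simp only [hr] at this
    simp only [LinearMap.toSpanSingleton_apply, LinearMap.smul_apply, Submodule.subtype_apply,
      smul_eq_mul]
    linear_combination -this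

/-! ### Global dimension and the non-DW criterion -/

/-- Quotients of injective modules over a principal ideal domain are injective. -/
theorem Module.Injective.of_surjective_of_isPrincipalIdealRing {R : Type u} [CommRing R]
    [IsDomain R] [IsPrincipalIdealRing R] {I Q : Type u} [AddCommGroup I] [Module R I]
    [AddCommGroup Q] [Module R Q] [hI : Module.Injective R I] (π : I →ₗ[R] Q)
    (hπ : Function.Surjective π) : Module.Injective R Q := by
  refine Module.Baer.injective fun J g ↦ ?_
  -- Ideals of a principal ideal domain are projective, so `g` lifts to `I` before being extended.
  obtain ⟨h, hh⟩ := Module.projective_lifting_property π g hπ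
  obtain ⟨h', hh'⟩ := Module.Baer.of_injective hI J h
  exact ⟨π ∘ₗ h', fun x hx ↦ by rw [LinearMap.comp_apply, hh' x hx, ← LinearMap.comp_apply, hh]⟩

/-- Principal ideal domains have global dimension at most `1`. -/
theorem ringGlobalDim_le_one (R : Type u) [CommRing R] [IsDomain R] [IsPrincipalIdealRing R] :
    ringGlobalDim R ≤ 1 := by
  refine iSup_le fun M ↦ (projectiveDimension_le_iff M 1).mpr
    (hasProjectiveDimensionLT_of_enoughInjectives M 2 fun N ↦ ?_)
  obtain ⟨I, _, _, hI, i, hi⟩ := exists_injective_embedding R N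
  let S := ModuleCat.shortComplexOfCompEqZero i (LinearMap.range i).mkQ
    (LinearMap.range_mkQ_comp i)
  have hS : S.ShortExact := ModuleCat.shortComplex_shortExact S
    (LinearMap.exact_map_mkQ_range i) hi (LinearMap.range i).mkQ_surjective
  have hQ := Module.Injective.of_surjective_of_isPrincipalIdealRing (LinearMap.range i).mkQ
    (LinearMap.range i).mkQ_surjective
  have h2 : Injective S.X₂ := (Module.injective_iff_injective_object R I).mp hI
  have h3 : Injective S.X₃ := (Module.injective_iff_injective_object R _).mp hQ
  -- Dimension shift: `Ext¹(M, I/N)` surjects onto `Ext²(M, N)`.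
  have hsurj := postcomp_extClass_surjective_of_projective_X₂ hS M 1
  have : Subsingleton (Abelian.Ext M S.X₃ 1) :=
    ⟨fun a b ↦ by rw [a.eq_zero_of_injective, b.eq_zero_of_injective]⟩
  exact hsurj.subsingleton

open IsLocalRing in
/-- Regular local rings of global dimension at least `2` are not DW-rings. -/
theorem IsRegularLocalRing.not_isDWRing {R : Type u} [CommRing R] [IsRegularLocalRing R]
    (h : 2 ≤ ringGlobalDim R) : ¬ IsDWRing R := by
  have hdom := IsRegularLocalRing.isDomain R
  have hfg := (maximalIdeal R).fg_of_isNoetherianRing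
  have hnp : ¬ (maximalIdeal R).IsPrincipal := fun hp ↦ by
    have : IsPrincipalIdealRing R :=
      ((tfae_of_isNoetherianRing_of_isLocalRing_of_isDomain R).out 4 0).mp hp
    exact absurd (h.trans (ringGlobalDim_le_one R)) (by decide)
  obtain ⟨x, hx, hx2⟩ : ∃ x ∈ maximalIdeal R, x ∉ maximalIdeal R ^ 2 := by
    by_contra! hle
    have : maximalIdeal R = ⊥ := by
      refine Submodule.eq_bot_of_le_smul_of_le_jacobson_bot (maximalIdeal R) _ hfg ?_ ?_
      · rw [smul_eq_mul, ← pow_two]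
        exact hle
      · exact (jacobson_eq_maximalIdeal ⊥ bot_ne_top).ge
    exact hnp (this ▸ inferInstance)
  have hreg := IsRegularLocalRing.quotient_span_singleton hx hx2
  have hprime : (Ideal.span {x}).IsPrime :=
    (Ideal.Quotient.isDomain_iff_prime _).mp (IsRegularLocalRing.isDomain _)
  have hx0 : x ≠ 0 := fun h0 ↦ hx2 (h0 ▸ zero_mem _)
  refine (isGVIdeal_of_prime_of_lt hfg ((Ideal.span_singleton_prime hx0).mp hprime)
    (lt_of_le_of_ne ((Ideal.span_singleton_le_iff_mem _).mpr hx) fun h ↦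
      hnp ⟨x, h.symm⟩)).not_isDWRing Ideal.IsPrime.ne_top'

theorem mainTheorem9 {R : Type u} [CommRing R] [IsLocalRing R] :
    (¬ IsDWRing R →
      ∀ (M : Type u) [AddCommGroup M] [Module R M],
        Module.Finite R M → IsWFPProjective R M → Module.Free R M) ∧
    (IsRegularLocalRing R → 2 ≤ ringGlobalDim R → ¬ IsDWRing R) :=
  ⟨fun hR _ _ _ _ hM ↦ hM.free_of_not_isDWRing hR,
    fun _ h ↦ IsRegularLocalRing.not_isDWRing h⟩
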